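/- **Execution model.** Addresses are natural numbers, some of which (given by an arbitrary predicate) are contract addresses; amounts are integers. A blockchain state consists of a chain height, a slot number (time), a finalized height, the account balance of every address, and, at addresses where a contract is deployed, the contract and its (serialised) local state. A contract is a pair of partial functions: $\mathtt{init}$ (chain, call context, setup $\mapsto$ local state) and $\mathtt{receive}$ (chain, call context, local state, optional message $\mapsto$ new local state and a list of emitted actions). An action, issued by an address, is a transfer, a call with a message, or a deployment, each with an attached amount. Start from the empty state (all balances $0$, no contracts, no outstanding actions) and use the following steps. (i) If no action is outstanding, a valid block (height increased by one, strictly larger slot, non-decreasing finalized height below the block height, non-negative reward, creator not a contract address) is added; its reward is paid to the creator, and its actions, all issued by non-contract addresses, become outstanding. (ii) The first outstanding action is executed: its amount must be non-negative and at most the issuer's balance, and is moved to the recipient. A transfer goes to a non-contract address or calls a deployed contract without message; a call runs $\mathtt{receive}$ of a deployed contract; a deployment runs $\mathtt{init}$ at an unused contract address. The partial function must succeed, the resulting local state is stored, and the emitted actions are put in front of the outstanding ones. (iii) The outstanding actions are permuted. A state (with its outstanding actions) is *reachable* if a finite sequence of steps leads to it. A *chain builder* is any type of builders, with an initial builder,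 a partial operation adding a block (header and list of actions) to a builder, and an environment for each builder, such that the environment of each builder, with no outstanding actions, is reachable. **Crowdfunding contract.** The local state has fields balance, donations (a finite map from addresses to integers, kept as an association list), owner, deadline, done, goal. Initially balance is $0$, donations is empty, the owner is the deployer, done is false, and the deadline and the goal are given by the setup. Calls without message fail. With $\mathit{now}$ the current slot, a call with message - *Donate* succeeds iff $\mathit{now}\le$ deadline; it adds the attached amount to the balance and to the sender's entry in donations; - *GetFunds* succeeds iff the sender is the owner, deadline $<\mathit{now}$ and goal $\le$ balance; it sets balance to $0$ and done to true, and emits a transfer of the previous balance to the sender; - *Claim* succeeds iff deadline $<\mathit{now}$, balance $<$ goal, not done, and the sender has an entry $v$ in donations; it sets this entry to $0$, lowers balance by $v$, and emits a transfer of $v$ to the sender. A local state is *balance-consistent* if, unless done is true, the sum of all values in donations equals balance. **Theorem.** 1. In every reachable state (with or without outstanding actions) in which the crowdfunding contract is deployed at an address $a$ with local state $\ell$, the local state $\ell$ is balance-consistent. 2. For every chain builder: if adding a block to a builder succeeds and yields a new builder in whose environment the crowdfunding contract is deployed at $a$ with local state $\ell$, then the account balance of $a$ in that environment is at least the balance recorded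 in $\ell$. 3. Likewise, in every reachable state without outstanding actions (that is, after the blocks added so far have been completely executed) in which the crowdfunding contract is deployed at $a$ with local state $\ell$, the account balance of $a$ is at least the balance recorded in $\ell$. -/

import Mathlib

/-! ## Serialised values -/

namespace Serialization

/-- Codes for the types whose values can be stored on the chain. -/
inductive SerializedType : Type
  | unit
  | int
  | bool
  | pair (a b : SerializedType)
  | list (a : SerializedType)

/-- The type denoted by a code. -/
def SerializedType.interp : SerializedType → Type
  | .unit => Unit
  | .int => ℤ
  | .bool => Bool
  | .pair a b => a.interp × b.interp
  | .list a => List a.interp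

/-- A serialised value: a code together with an element of the type it denotes. -/
structure SerializedValue : Type where
  type : SerializedType
  value : type.interp

/-- Types that can be serialised, with a partial left inverse of serialisation. -/
class Serializable (α : Type) where
  serialize : α → SerializedValue
  deserialize : SerializedValue → Option α
  deserialize_serialize : ∀ x : α, deserialize (serialize x) = some x
instance : Serializable ℤ where
  serialize z := ⟨.int, z⟩
  deserialize
    | ⟨.int, z⟩ => some z
    | _ => none
  deserialize_serialize _ := rfl

instance : Serializable Bool where
  serialize b := ⟨.bool, b⟩
  deserialize
    | ⟨.bool, b⟩ => some b
    | _ => none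
  deserialize_serialize _ := rfl

/-- A natural number is stored as an integer; negative integers are rejected when reading. -/
instance : Serializable ℕ where
  serialize n := ⟨.int, (n : ℤ)⟩
  deserialize
    | ⟨.int, z⟩ => Int.toNat? z
    | _ => none
  deserialize_serialize _ := rfl

instance {α β : Type} [Serializable α] [Serializable β] : Serializable (α × β) where
  serialize p :=
    ⟨.pair (Serializable.serialize p.1).type (Serializable.serialize p.2).type,
      ((Serializable.serialize p.1).value, (Serializable.serialize p.2).value)⟩
  deserialize
    | ⟨.pair a b, (x, y)⟩ =>
        (Serializable.deserialize ⟨a, x⟩).bind fun u =>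
          (Serializable.deserialize ⟨b, y⟩).bind fun v => some (u, v)
    | _ => none
  deserialize_serialize p := by
    have h1 := Serializable.deserialize_serialize p.1
    have h2 := Serializable.deserialize_serialize p.2
    simp only [h1, h2, Option.bind_some]

end Serialization

/-! ## The blockchain execution model -/

namespace Blockchain

open Serialization

/-- Addresses are natural numbers. Which of them are contract addresses is a parameter
`isContract : Address → Bool` of the execution model. -/
abbrev Address : Type := ℕ

/-- Amounts of money. -/
abbrev Amount : Type := ℤ

/-- The part of the blockchain state that contracts can inspect. -/
structure Chain : Type where
  chainHeight : ℕ
  currentSlot : ℕ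
  finalizedHeight : ℕ
  accountBalance : Address → Amount

/-- Information on the call being executed. -/
structure ContractCallContext : Type where
  ctxFrom : Address
  ctxContractAddress : Address
  ctxAmount : Amount

mutual
/-- Actions: transfer money, call a contract with a message, deploy a contract. -/
inductive ActionBody : Type
  | transfer (dst : Address) (amount : Amount)
  | call (dst : Address) (amount : Amount) (msg : SerializedValue)
  | deploy (amount : Amount) (c : WeakContract) (setup : SerializedValue)
/-- A contract as seen by the chain: the partial functions `init` and `receive` on serialised
data. (Functions of a `Chain` respect pointwise equality of chains automatically.) -/
inductive WeakContract : Type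
  | mk
    (init : Chain → ContractCallContext → SerializedValue → Option SerializedValue)
    (receive : Chain → ContractCallContext → SerializedValue → Option SerializedValue →
      Option (SerializedValue × List ActionBody))
end

/-- The `init` function: chain, context and setup are mapped to the initial local state. -/
def WeakContract.init : WeakContract →
    Chain → ContractCallContext → SerializedValue → Option SerializedValue
  | .mk i _ => i

/-- The `receive` function: chain, context, local state and optional message are mapped to the
new local state and the actions the contract emits. -/
def WeakContract.receive : WeakContract →
    Chain → ContractCallContext → SerializedValue → Option SerializedValue →
      Option (SerializedValue × List ActionBody)
  | .mk _ r => r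

/-- A contract on typed data. -/
structure Contract (Setup Msg State : Type) : Type where
  init : Chain → ContractCallContext → Setup → Option State
  receive : Chain → ContractCallContext → State → Option Msg → Option (State × List ActionBody)

/-- The contract on serialised data given by a contract on typed data: inputs are deserialised
(and the call fails if that is impossible), the resulting local state is serialised. -/
def Contract.toWeak {Setup Msg State : Type}
    [Serializable Setup] [Serializable Msg] [Serializable State]
    (c : Contract Setup Msg State) : WeakContract :=
  .mk
    (fun chain ctx serSetup =>
      (Serializable.deserialize serSetup).bind fun setup =>
        (c.init chain ctx setup).map Serializable.serialize)
    (fun chain ctx serState serMsg =>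
      (Serializable.deserialize serState).bind fun state =>
        match serMsg with
        | none =>
            (c.receive chain ctx state none).map fun r => (Serializable.serialize r.1, r.2)
        | some m =>
            (Serializable.deserialize m).bind fun msg =>
              (c.receive chain ctx state (some msg)).map fun r =>
                (Serializable.serialize r.1, r.2))

/-- An action together with the account or contract that issues it. -/
structure Action : Type where
  actFrom : Address
  actBody : ActionBody

/-- The full state of the blockchain: the chain, the deployed contracts and their local states. -/
structure Environment : Type where
  chain : Chain
  contracts : Address → Option WeakContract
  contractStates : Address → Option SerializedValue

/-- Add `amount` to the balance of `addr`. -/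
def addBalance (addr : Address) (amount : Amount) (balance : Address → Amount) :
    Address → Amount :=
  fun a => if a = addr then amount + balance a else balance a

def Environment.transferBalance (src dst : Address) (amount : Amount) (env : Environment) :
    Environment :=
  { env with
    chain := { env.chain with
      accountBalance := addBalance dst amount (addBalance src (-amount) env.chain.accountBalance) } }

def Environment.addContract (addr : Address) (wc : WeakContract) (env : Environment) :
    Environment :=
  { env with contracts := Function.update env.contracts addr (some wc) }

def Environment.setContractState (addr : Address) (state : SerializedValue) (env : Environment) :
    Environment :=
  { env with contractStates := Function.update env.contractStates addr (some state) }

/-- The action that calls a contract; without a message this is a plain transfer. -/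
def callBody (dst : Address) (amount : Amount) : Option SerializedValue → ActionBody
  | none => .transfer dst amount
  | some m => .call dst amount m

/-- `ActionEvaluation isContract env act env' newActs`: in `env` the action `act` can be executed,
this leads to `env'`, and `newActs` are the actions emitted by the contract that was called. -/
inductive ActionEvaluation (isContract : Address → Bool) (env : Environment) :
    Action → Environment → List Action → Prop
  /-- A transfer of money to a user account. -/
  | transfer (src dst : Address) (amount : Amount)
      (nonneg : 0 ≤ amount)
      (enough : amount ≤ env.chain.accountBalance src)
      (to_user : isContract dst = false) :
      ActionEvaluation isContract env ⟨src, .transfer dst amount⟩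
        (env.transferBalance src dst amount) []
  /-- The deployment of a contract at an unused contract address. -/
  | deploy (src dst : Address) (amount : Amount) (wc : WeakContract)
      (setup state : SerializedValue)
      (nonneg : 0 ≤ amount)
      (enough : amount ≤ env.chain.accountBalance src)
      (to_contract : isContract dst = true)
      (unused : env.contracts dst = none)
      (init_ok : wc.init (env.transferBalance src dst amount).chain ⟨src, dst, amount⟩ setup
        = some state) :
      ActionEvaluation isContract env ⟨src, .deploy amount wc setup⟩
        (((env.transferBalance src dst amount).addContract dst wc).setContractState dst state) []
  /-- A call of a deployed contract; a plain transfer to a contract is a call without message. -/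
  | call (src dst : Address) (amount : Amount) (wc : WeakContract)
      (msg : Option SerializedValue) (state newState : SerializedValue)
      (response : List ActionBody)
      (nonneg : 0 ≤ amount)
      (enough : amount ≤ env.chain.accountBalance src)
      (deployed : env.contracts dst = some wc)
      (has_state : env.contractStates dst = some state)
      (receive_ok : wc.receive (env.transferBalance src dst amount).chain ⟨src, dst, amount⟩
        state msg = some (newState, response)) :
      ActionEvaluation isContract env
        ⟨src, callBody dst amount msg⟩
        ((env.transferBalance src dst amount).setContractState dst newState)
        (response.map fun body => ⟨dst, body⟩)

structure BlockHeader : Type where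
  blockHeight : ℕ
  blockSlot : ℕ
  blockFinalizedHeight : ℕ
  blockReward : Amount
  blockCreator : Address

/-- Record the data of a new block and pay the reward to its creator. -/
def Environment.addNewBlock (header : BlockHeader) (env : Environment) : Environment :=
  { env with
    chain :=
      { chainHeight := header.blockHeight
        currentSlot := header.blockSlot
        finalizedHeight := header.blockFinalizedHeight
        accountBalance :=
          addBalance header.blockCreator header.blockReward env.chain.accountBalance } }

structure IsValidNextBlock (isContract : Address → Bool) (header : BlockHeader) (chain : Chain) :
    Prop where
  valid_height : header.blockHeight = chain.chainHeight + 1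
  valid_slot : chain.currentSlot < header.blockSlot
  valid_finalized_height : chain.finalizedHeight ≤ header.blockFinalizedHeight ∧
    header.blockFinalizedHeight < header.blockHeight
  valid_creator : isContract header.blockCreator = false
  valid_reward : 0 ≤ header.blockReward

/-- A state of an execution: the blockchain state and the queue of outstanding actions. -/
structure ChainState : Type where
  env : Environment
  queue : List Action

/-- The small-step semantics of the blockchain. -/
inductive ChainStep (isContract : Address → Bool) : ChainState → ChainState → Prop
  /-- A new block is added once no actions are outstanding; its actions come from user accounts. -/
  | block (env : Environment) (header : BlockHeader) (acts : List Action)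
      (valid : IsValidNextBlock isContract header env.chain)
      (from_users : ∀ act ∈ acts, isContract act.actFrom = false) :
      ChainStep isContract ⟨env, []⟩ ⟨env.addNewBlock header, acts⟩
  /-- The first outstanding action is executed; the actions it causes are put in front. -/
  | action (env env' : Environment) (act : Action) (acts newActs : List Action)
      (eval : ActionEvaluation isContract env act env' newActs) :
      ChainStep isContract ⟨env, act :: acts⟩ ⟨env', newActs ++ acts⟩
  /-- The outstanding actions are reordered. -/
  | permute (env : Environment) (acts acts' : List Action) (perm : acts.Perm acts') :
      ChainStep isContract ⟨env, acts⟩ ⟨env, acts'⟩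

/-- The state before the first block. -/
def ChainState.empty : ChainState where
  env :=
    { chain :=
        { chainHeight := 0
          currentSlot := 0
          finalizedHeight := 0
          accountBalance := fun _ => 0 }
      contracts := fun _ => none
      contractStates := fun _ => none }
  queue := []

/-- A state is reachable if some finite trace of steps leads to it from the empty state. -/
def Reachable (isContract : Address → Bool) (s : ChainState) : Prop :=
  Relation.ReflTransGen (ChainStep isContract) ChainState.empty s

/-- Implementations of blockchain execution that follow the small-step semantics: `addBlock`
tries to add a block with the given header and actions and to execute all of its actions, and
the environment of every builder is reached by a trace that leaves no action outstanding. -/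
structure ChainBuilderType.{u} (isContract : Address → Bool) : Type (u + 1) where
  Builder : Type u
  initial : Builder
  env : Builder → Environment
  addBlock : Builder → BlockHeader → List Action → Option Builder
  trace : ∀ b : Builder, Reachable isContract ⟨env b, []⟩

end Blockchain

/-! ## The crowdfunding contract -/

namespace Crowdfunding

open Serialization

/-- Finite maps as association lists. -/
inductive AcornMap (A B : Type) : Type
  | nil
  | cons (key : A) (value : B) (rest : AcornMap A B)

namespace AcornMap

/-- The value stored for a key. -/
def find {A B : Type} [DecidableEq A] (k : A) : AcornMap A B → Option B
  | nil => none
  | cons k' v m => if k = k' then some v else find k m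

/-- Store a value for a key, replacing the value stored before. -/
def add {A B : Type} [DecidableEq A] (k : A) (v : B) : AcornMap A B → AcornMap A B
  | nil => cons k v nil
  | cons k' v' m => if k = k' then cons k' v m else cons k' v' (add k v m)

end AcornMap

abbrev Address : Type := ℕ

abbrev Money : Type := ℤ

/-- Donations, by address of the donor. -/
abbrev DonationMap : Type := AcornMap Address Money

/-- The sum of all values of the map. -/
def sumMap : DonationMap → Money
  | .nil => 0
  | .cons _ v m => v + sumMap m

/-- The local state of the contract. -/
structure State : Type where
  balance : Money
  donations : DonationMap
  owner : Address
  deadline : ℕ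
  done : Bool
  goal : Money

inductive Msg : Type
  | donate
  | getFunds
  | claim

/-- The contract's view of the chain, of the call context and of the actions it can issue. -/
structure SimpleChain : Type where
  height : ℕ
  curTime : ℕ
  finalizedHeight : ℕ
  accountBalance : Address → Money

structure SimpleContractCallContext : Type where
  ctxFrom : Address
  contractAddress : Address
  amount : Money

inductive SimpleActionBody : Type
  | transfer (amount : Money) (dst : Address)

/-- The initial local state for a given deadline and goal. -/
def init (c : SimpleContractCallContext) (dl : ℕ) (g : Money) : State where
  balance := 0
  donations := .nil
  owner := c.ctxFrom
  deadline := dl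
  done := false
  goal := g

/-- The main functionality of the contract. -/
def receive (chain : SimpleChain) (c : SimpleContractCallContext) (m : Msg) (s : State) :
    Option (State × List SimpleActionBody) :=
  let bal := s.balance
  let now := chain.curTime
  let txAmount := c.amount
  let sender := c.ctxFrom
  let own := s.owner
  let accs := s.donations
  match m with
  | .getFunds =>
      if own = sender ∧ s.deadline < now ∧ s.goal ≤ bal then
        some (⟨0, accs, own, s.deadline, true, s.goal⟩, [.transfer bal sender])
      else none
  | .donate =>
      if now ≤ s.deadline then
        match accs.find sender with
        | some v =>
            some (⟨txAmount + bal, accs.add sender (v + txAmount), own, s.deadline, s.done,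
              s.goal⟩, [])
        | none =>
            some (⟨txAmount + bal, accs.add sender txAmount, own, s.deadline, s.done, s.goal⟩, [])
      else none
  | .claim =>
      if s.deadline < now ∧ bal < s.goal ∧ s.done = false then
        match accs.find sender with
        | some v =>
            some (⟨bal - v, accs.add sender 0, own, s.deadline, s.done, s.goal⟩,
              [.transfer v sender])
        | none => none
      else none

/-- Before the contract is done, the individual contributions sum to the recorded balance. -/
def ConsistentBalance (s : State) : Prop :=
  ¬ s.done = true → sumMap s.donations = s.balance

/-! Serialisation of donations, local states and messages. -/

def serializeMap : DonationMap → SerializedValue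
  | .nil => ⟨.unit, ()⟩
  | .cons k v m =>
      ⟨.pair (.pair .int .int) (serializeMap m).type, (((k : ℤ), v), (serializeMap m).value)⟩

def deserializeMap : (t : SerializedType) → t.interp → Option DonationMap
  | .unit, _ => some .nil
  | .pair (.pair .int .int) t, ((k, v), m) =>
      (Int.toNat? k).bind fun k' => (deserializeMap t m).map fun m' => .cons k' v m'
  | _, _ => none

theorem deserializeMap_serializeMap (m : DonationMap) :
    deserializeMap (serializeMap m).type (serializeMap m).value = some m := by
  induction m with
  | nil => rfl
  | cons k v m ih =>
    simp only [serializeMap, deserializeMap, ih]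
    rfl

instance : Serializable DonationMap where
  serialize := serializeMap
  deserialize s := deserializeMap s.type s.value
  deserialize_serialize := deserializeMap_serializeMap

instance : Serializable State where
  serialize s :=
    Serializable.serialize (s.balance, s.donations, s.owner, s.deadline, s.done, s.goal)
  deserialize v :=
    (Serializable.deserialize (α := Money × DonationMap × Address × ℕ × Bool × Money) v).map
      fun p => ⟨p.1, p.2.1, p.2.2.1, p.2.2.2.1, p.2.2.2.2.1, p.2.2.2.2.2⟩
  deserialize_serialize s := by
    simp only [Serializable.deserialize_serialize, Option.map_some]

instance : Serializable Msg where
  serialize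
    | .donate => Serializable.serialize (0 : ℕ)
    | .getFunds => Serializable.serialize (1 : ℕ)
    | .claim => Serializable.serialize (2 : ℕ)
  deserialize v :=
    match Serializable.deserialize (α := ℕ) v with
    | some 0 => some .donate
    | some 1 => some .getFunds
    | some 2 => some .claim
    | _ => none
  deserialize_serialize m := by cases m <;> rfl

/-! Wrapping of `init` and `receive` for the execution model. -/

def ofChain (c : Blockchain.Chain) : SimpleChain :=
  ⟨c.chainHeight, c.currentSlot, c.finalizedHeight, c.accountBalance⟩

def ofContractCallContext (c : Blockchain.ContractCallContext) : SimpleContractCallContext :=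
  ⟨c.ctxFrom, c.ctxContractAddress, c.ctxAmount⟩

def toActionBody : SimpleActionBody → Blockchain.ActionBody
  | .transfer amount dst => .transfer dst amount

/-- Deadline and goal. -/
abbrev Setup : Type := ℕ × Money

def wrappedInit (_ : Blockchain.Chain) (c : Blockchain.ContractCallContext) (setup : Setup) :
    Option State :=
  some (init (ofContractCallContext c) setup.1 setup.2)

/-- Calls without message are rejected. -/
def wrappedReceive (chain : Blockchain.Chain) (c : Blockchain.ContractCallContext) (s : State)
    (msg : Option Msg) : Option (State × List Blockchain.ActionBody) :=
  match msg with
  | none => none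
  | some m =>
      (receive (ofChain chain) (ofContractCallContext c) m s).map fun r =>
        (r.1, r.2.map toActionBody)

/-- The crowdfunding contract. -/
def cfContract : Blockchain.Contract Setup Msg State where
  init := wrappedInit
  receive := wrappedReceive

/-- The local state stored at an address, read as a local state of the crowdfunding contract. -/
def cfState (env : Blockchain.Environment) (addr : Blockchain.Address) : Option State :=
  (env.contractStates addr).bind Serializable.deserialize

end Crowdfunding

-- Consistency is preserved by each call separately, by `sumMap_add`: a donation changes one entry
-- and the balance by the same amount, a claim lowers both by the entry, and `getFunds` sets `done`,
-- after which nothing is required.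
--
-- Solvency fails to be inductive as stated, since an emitted payout leaves the recorded balance
-- before it leaves the account. The inductive form adds the payouts still queued: recorded balance
-- + `outgoing` ≤ account balance, in every reachable state. A call turns recorded balance into
-- emitted transfers without creating money (`receive_spec`); executing a queued action of the
-- contract lowers the queue total and the account alike. With an empty queue the bound is the
-- claim. It does not rely on consistency.
--
-- `Invariant` adds what this induction needs. Nonnegative accounts cover the balance 0 at
-- deployment; silence of unused contract addresses makes the queue total 0 at that moment. Deployed
-- contracts sit at contract addresses, so neither new blocks nor transfers to users interfere.
-- Finally, the crowdfunding contract only queues transfers and rejects calls without message, so it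
-- never calls itself.

namespace Crowdfunding

open Serialization

-- Sums over donation maps.

/-- The sum of the values after storing `v` for the key `k`. -/
theorem sumMap_add (k : Address) (v : Money) (m : DonationMap) :
    sumMap (m.add k v) = sumMap m - (m.find k).getD 0 + v := by
  induction m with
  | nil => simp [AcornMap.add, AcornMap.find, sumMap]
  | cons k' v' m ih =>
    -- `find` and `add` both stop at the first occurrence of `k`, so repeated keys do no harm; an
    -- absent key counts as 0.
    by_cases h : k = k'
    · simp [AcornMap.add, AcornMap.find, sumMap, h]
      ring
    · simp [AcornMap.add, AcornMap.find, sumMap, h, ih]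
      ring

end Crowdfunding

-- Queued amounts and account balances.

namespace Blockchain

open Serialization

/-- The amount attached to an action. -/
def ActionBody.amount : ActionBody → Amount
  | .transfer _ x => x
  | .call _ x _ => x
  | .deploy x _ _ => x

/-- The total amount attached to the actions in `q` that are issued by `a`. -/
def outgoing (a : Address) (q : List Action) : Amount :=
  (q.map fun act => if act.actFrom = a then act.actBody.amount else 0).sum

theorem outgoing_cons (a : Address) (act : Action) (q : List Action) :
    outgoing a (act :: q) =
      (if act.actFrom = a then act.actBody.amount else 0) + outgoing a q := by
  simp [outgoing]

theorem outgoing_append (a : Address) (q q' : List Action) :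
    outgoing a (q ++ q') = outgoing a q + outgoing a q' := by
  simp [outgoing]

theorem outgoing_perm (a : Address) {q q' : List Action} (h : q.Perm q') :
    outgoing a q = outgoing a q' :=
  (h.map _).sum_eq

theorem outgoing_eq_zero {a : Address} {q : List Action} (h : ∀ act ∈ q, act.actFrom ≠ a) :
    outgoing a q = 0 := by
  apply List.sum_eq_zero
  intro x hx
  obtain ⟨act, hact, rfl⟩ := List.mem_map.1 hx
  simp [h act hact]

theorem outgoing_map (a b : Address) (r : List ActionBody) :
    outgoing a (r.map fun body => ⟨b, body⟩) =
      if b = a then (r.map ActionBody.amount).sum else 0 := by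
  by_cases h : b = a <;> simp [outgoing, h, Function.comp_def]

theorem callBody_amount (dst : Address) (x : Amount) (msg : Option SerializedValue) :
    (callBody dst x msg).amount = x := by
  cases msg <;> rfl

/-- Written as two independent corrections so that `src = dst` needs no separate case: they cancel.
-/
theorem transferBalance_balance (src dst : Address) (x : Amount) (env : Environment)
    (a : Address) :
    (env.transferBalance src dst x).chain.accountBalance a =
      env.chain.accountBalance a + (if a = dst then x else 0) - (if a = src then x else 0) := by
  simp only [Environment.transferBalance, addBalance]
  split_ifs <;> ring

theorem transferBalance_nonneg {src : Address} (dst : Address) {x : Amount} {env : Environment}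
    (h : ∀ a, 0 ≤ env.chain.accountBalance a) (hx : 0 ≤ x)
    (hsrc : x ≤ env.chain.accountBalance src) (a : Address) :
    0 ≤ (env.transferBalance src dst x).chain.accountBalance a := by
  rw [transferBalance_balance]
  have := h a
  by_cases ha : a = src
  · subst ha
    split_ifs <;> linarith
  · simp only [ha, if_false]
    split_ifs <;> linarith

end Blockchain

-- Single calls of the crowdfunding contract.

namespace Crowdfunding

open Serialization Blockchain

/-- The typed contract preserves consistency and does not create money; what it emits are
transfers. -/
theorem receive_spec {chain : SimpleChain} {ctx : SimpleContractCallContext} {m : Msg}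
    {s s' : State} {r : List SimpleActionBody}
    (h : receive chain ctx m s = some (s', r)) (hx : 0 ≤ ctx.amount) :
    (ConsistentBalance s → ConsistentBalance s') ∧
      ((r.map toActionBody).map ActionBody.amount).sum + s'.balance ≤ s.balance + ctx.amount := by
  have hsum := fun v => sumMap_add ctx.ctxFrom v s.donations
  cases m <;> simp only [receive] at h
  · split_ifs at h
    split at h <;> rename_i hf <;> cases h <;> simp only [hf] at hsum <;>
      refine ⟨fun hc hd => ?_, ?_⟩
    · have := hc hd
      simp only [hsum, Option.getD_some]
      linarith
    · simp [add_comm]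
    · have := hc hd
      simp only [hsum, Option.getD_none]
      linarith
    · simp [add_comm]
  · split_ifs at h
    cases h
    -- `getFunds` sets `done`, so consistency of the new state is vacuous.
    refine ⟨fun _ hd => absurd rfl hd, ?_⟩
    -- The payout equals the drop in recorded balance; the attached amount is not recorded, which is
    -- why only an inequality holds. The same slack appears for `claim`.
    simpa [toActionBody, ActionBody.amount] using hx
  · split_ifs at h
    split at h <;> rename_i hf <;> cases h
    simp only [hf] at hsum
    refine ⟨fun hc hd => ?_, ?_⟩
    · have := hc hd
      simp only [hsum, Option.getD_some]
      linarith
    · simpa [toActionBody, ActionBody.amount] using hx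

/-- Transports `receive_spec` through serialisation. The conjuncts `msg ≠ none` and "only transfers
are emitted" together exclude calls of the contract by itself. -/
theorem toWeak_receive_spec {chain : Chain} {ctx : ContractCallContext} {st st' : SerializedValue}
    {msg : Option SerializedValue} {r : List ActionBody}
    (h : cfContract.toWeak.receive chain ctx st msg = some (st', r)) (hx : 0 ≤ ctx.ctxAmount) :
    ∃ l l' : State, Serializable.deserialize st = some l ∧
      Serializable.deserialize st' = some l' ∧ msg ≠ none ∧
      (ConsistentBalance l → ConsistentBalance l') ∧
      (∀ body ∈ r, ∃ dst x, body = .transfer dst x) ∧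
      (r.map ActionBody.amount).sum + l'.balance ≤ l.balance + ctx.ctxAmount := by
  simp only [Contract.toWeak, WeakContract.receive, Option.bind_eq_some_iff] at h
  obtain ⟨l, hl, h⟩ := h
  cases msg with
  | none => simp [cfContract, wrappedReceive] at h
  | some msg =>
    simp only [cfContract, wrappedReceive, Option.bind_eq_some_iff, Option.map_eq_some_iff] at h
    obtain ⟨m, -, _, ⟨⟨l', r'⟩, hr, rfl⟩, h⟩ := h
    cases h
    obtain ⟨hc, hb⟩ := receive_spec hr hx
    refine ⟨l, l', hl, Serializable.deserialize_serialize _, by simp, hc, ?_, hb⟩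
    intro body hbody
    obtain ⟨⟨x, dst⟩, -, rfl⟩ := List.mem_map.1 hbody
    exact ⟨dst, x, rfl⟩

theorem toWeak_init_spec {chain : Chain} {ctx : ContractCallContext} {setup st : SerializedValue}
    (h : cfContract.toWeak.init chain ctx setup = some st) :
    ∃ l : State, Serializable.deserialize st = some l ∧ ConsistentBalance l ∧ l.balance = 0 := by
  simp only [Contract.toWeak, WeakContract.init, cfContract, wrappedInit,
    Option.bind_eq_some_iff, Option.map_eq_some_iff] at h
  obtain ⟨setup', -, l, h, rfl⟩ := h
  cases h
  exact ⟨_, Serializable.deserialize_serialize _, fun _ => rfl, rfl⟩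

-- The invariant and its preservation by the steps.

/-- What holds at an address with the crowdfunding contract: its outstanding actions are
transfers, and for its local state the account covers the recorded balance and all outstanding
transfers. -/
structure Sound (s : ChainState) (a : Blockchain.Address) : Prop where
  transfers : ∀ act ∈ s.queue, act.actFrom = a → ∃ dst x, act.actBody = .transfer dst x
  consistent : ∀ l, cfState s.env a = some l → ConsistentBalance l
  covered : ∀ l, cfState s.env a = some l →
    l.balance + outgoing a s.queue ≤ s.env.chain.accountBalance a

/-- The invariant of the execution. -/
structure Invariant (isContract : Blockchain.Address → Bool) (s : ChainState) : Prop where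
  nonneg : ∀ a, 0 ≤ s.env.chain.accountBalance a
  isContract_of_deployed : ∀ a, s.env.contracts a ≠ none → isContract a = true
  silent : ∀ a, isContract a = true → s.env.contracts a = none →
    ∀ act ∈ s.queue, act.actFrom ≠ a
  sound : ∀ a, s.env.contracts a = some cfContract.toWeak → Sound s a

variable {isContract : Blockchain.Address → Bool}

theorem Invariant.empty : Invariant isContract ChainState.empty where
  nonneg _ := le_rfl
  isContract_of_deployed _ h := absurd rfl h
  silent _ _ _ _ h := by simp [ChainState.empty] at h
  sound _ h := by simp [ChainState.empty] at h

theorem Invariant.block {env : Environment} {header : BlockHeader} {acts : List Action}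
    (valid : IsValidNextBlock isContract header env.chain)
    (from_users : ∀ act ∈ acts, isContract act.actFrom = false)
    (inv : Invariant isContract ⟨env, []⟩) :
    Invariant isContract ⟨env.addNewBlock header, acts⟩ := by
  have hr := valid.valid_reward
  have hmono : ∀ a, env.chain.accountBalance a ≤
      (env.addNewBlock header).chain.accountBalance a := by
    intro a
    simp only [Environment.addNewBlock, addBalance]
    split_ifs <;> linarith
  have hne : ∀ a, isContract a = true → ∀ act ∈ acts, act.actFrom ≠ a := by
    rintro a ha act hact rfl
    simp [from_users act hact] at ha
  refine ⟨fun a => (inv.nonneg a).trans (hmono a), inv.isContract_of_deployed,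
    fun a ha _ => hne a ha, fun a ha => ?_⟩
  have hs := inv.sound a ha
  -- A deployed contract sits at a contract address, while block actions come from users: nothing
  -- queued is issued by `a`, and the reward can only help.
  have hc := hne a (inv.isContract_of_deployed a (ha ▸ by simp))
  refine ⟨fun act hact h => absurd h (hc act hact), hs.consistent, fun l hl => ?_⟩
  have hcov := hs.covered l hl
  have := hmono a
  simp only [outgoing, List.map_nil, List.sum_nil] at hcov
  simp only [outgoing_eq_zero hc]
  linarith

theorem Invariant.permute {env : Environment} {acts acts' : List Action}
    (perm : acts.Perm acts') (inv : Invariant isContract ⟨env, acts⟩) :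
    Invariant isContract ⟨env, acts'⟩ where
  nonneg := inv.nonneg
  isContract_of_deployed := inv.isContract_of_deployed
  silent a ha hn act hact := inv.silent a ha hn act (perm.mem_iff.2 hact)
  sound a ha :=
    { transfers := fun act hact => (inv.sound a ha).transfers act (perm.mem_iff.2 hact)
      consistent := (inv.sound a ha).consistent
      covered := fun l hl => outgoing_perm a perm ▸ (inv.sound a ha).covered l hl }

theorem Invariant.action {env env' : Environment} {act : Action} {acts newActs : List Action}
    (eval : ActionEvaluation isContract env act env' newActs)
    (inv : Invariant isContract ⟨env, act :: acts⟩) :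
    Invariant isContract ⟨env', newActs ++ acts⟩ := by
  have hsilent : ∀ a, isContract a = true → env.contracts a = none →
      ∀ act ∈ acts, act.actFrom ≠ a :=
    fun a ha hn act hact => inv.silent a ha hn act (List.mem_cons_of_mem _ hact)
  have htr : ∀ a, env.contracts a = some cfContract.toWeak → ∀ act ∈ acts, act.actFrom = a →
      ∃ dst x, act.actBody = .transfer dst x :=
    fun a ha act hact => (inv.sound a ha).transfers act (List.mem_cons_of_mem _ hact)
  cases eval with
  | transfer src dst x nonneg enough to_user =>
    refine ⟨transferBalance_nonneg dst inv.nonneg nonneg enough, inv.isContract_of_deployed,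
      hsilent, fun a ha => ⟨htr a ha, (inv.sound a ha).consistent, fun l hl => ?_⟩⟩
    have hcov := (inv.sound a ha).covered l hl
    -- The recipient is a user, so `a` can only be the payer; then its account and its queue total
    -- drop by the same `x`.
    have hne : a ≠ dst := by
      rintro rfl
      simp [inv.isContract_of_deployed a (ha ▸ by simp)] at to_user
    simp only [outgoing_cons, ActionBody.amount] at hcov
    -- `eq_comm` aligns the condition `a = src` with the `src = a` coming from `outgoing`, so that
    -- `linarith` sees one and the same term.
    simp only [transferBalance_balance, hne, if_false, List.nil_append, @eq_comm _ a src]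
    linarith
  | deploy src dst x wc setup st nonneg enough to_contract unused init_ok =>
    have hbal := transferBalance_nonneg dst inv.nonneg nonneg enough
    refine ⟨hbal, fun a ha => ?_, fun a ha hn => ?_, fun a ha => ?_⟩
    · by_cases h : a = dst
      · exact h ▸ to_contract
      · exact inv.isContract_of_deployed a (by
          simpa [Environment.setContractState, Environment.addContract,
            Environment.transferBalance, h] using ha)
    · by_cases h : a = dst
      · simp [Environment.setContractState, Environment.addContract, h] at hn
      · exact hsilent a ha (by
          simpa [Environment.setContractState, Environment.addContract,
            Environment.transferBalance, h] using hn)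
    · by_cases h : a = dst
      · subst h
        have hwc : wc = cfContract.toWeak := by
          simpa [Environment.setContractState, Environment.addContract] using ha
        subst hwc
        obtain ⟨l, hl, hc, hb⟩ := toWeak_init_spec init_ok
        -- Nothing was queued by `a` before its deployment, so its fresh balance 0 only has to be
        -- covered by a nonnegative account.
        have hq := hsilent a to_contract unused
        have hst : cfState (((env.transferBalance src a x).addContract a
            cfContract.toWeak).setContractState a st) a = some l := by
          simpa [cfState, Environment.setContractState] using hl
        refine ⟨fun act hact h => absurd h (hq act hact), fun l' hl' => ?_, fun l' hl' => ?_⟩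
        · obtain rfl := Option.some.inj (hst.symm.trans hl')
          exact hc
        · obtain rfl := Option.some.inj (hst.symm.trans hl')
          simp only [List.nil_append, outgoing_eq_zero hq, hb, add_zero]
          exact hbal a
      · have ha' : env.contracts a = some cfContract.toWeak := by
          simpa [Environment.setContractState, Environment.addContract,
            Environment.transferBalance, h] using ha
        have hst : cfState (((env.transferBalance src dst x).addContract dst
            wc).setContractState dst st) a = cfState env a := by
          simp [cfState, Environment.setContractState, Environment.addContract,
            Environment.transferBalance, h]
        refine ⟨htr a ha', fun l hl => (inv.sound a ha').consistent l (hst ▸ hl),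
          fun l hl => ?_⟩
        have hcov := (inv.sound a ha').covered l (hst ▸ hl)
        have hb := transferBalance_balance src dst x env a
        simp only [outgoing_cons, ActionBody.amount] at hcov
        simp only [h, if_false, @eq_comm _ a src] at hb
        change _ ≤ (env.transferBalance src dst x).chain.accountBalance a
        simp only [List.nil_append]
        linarith
  | call src dst x wc msg st st' response nonneg enough deployed has_state receive_ok =>
    refine ⟨transferBalance_nonneg dst inv.nonneg nonneg enough, inv.isContract_of_deployed,
      fun a ha hn act hact => ?_, fun a ha => ?_⟩
    · rcases List.mem_append.1 hact with hact | hact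
      · obtain ⟨body, -, rfl⟩ := List.mem_map.1 hact
        -- Emitted actions are issued by `dst`, where a contract is deployed.
        rintro rfl
        exact absurd (deployed.symm.trans hn) (by simp)
      · exact hsilent a ha hn act hact
    · change env.contracts a = some cfContract.toWeak at ha
      have hs := inv.sound a ha
      have hb := transferBalance_balance src dst x env a
      by_cases h : a = dst
      · subst h
        obtain rfl : wc = cfContract.toWeak := Option.some.inj (deployed.symm.trans ha)
        obtain ⟨l, l', hl, hl', hmsg, hc, ht, hsum⟩ := toWeak_receive_spec receive_ok nonneg
        have hold : cfState env a = some l := by simp [cfState, has_state, hl]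
        have hnew : cfState ((env.transferBalance src a x).setContractState a st') a
            = some l' := by
          simpa [cfState, Environment.setContractState] using hl'
        -- If `a` had issued this call, it would be a queued transfer, hence a call without message,
        -- which the contract rejects.
        have hsrc : src ≠ a := by
          intro h
          obtain ⟨d, y, hy⟩ := hs.transfers _ List.mem_cons_self h
          cases msg with
          | none => exact hmsg rfl
          | some m => simp [callBody] at hy
        refine ⟨fun act hact => ?_, fun l₁ hl₁ => ?_, fun l₁ hl₁ => ?_⟩
        · rcases List.mem_append.1 hact with hact | hact
          · obtain ⟨body, hbody, rfl⟩ := List.mem_map.1 hact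
            exact fun _ => ht body hbody
          · exact htr a ha act hact
        · obtain rfl := Option.some.inj (hnew.symm.trans hl₁)
          exact hc (hs.consistent l hold)
        · obtain rfl := Option.some.inj (hnew.symm.trans hl₁)
          -- The account gains `x`, and by `hsum` the new recorded balance plus the emitted
          -- transfers exceeds the old recorded balance by at most `x`.
          have hcov := hs.covered l hold
          simp only [outgoing_cons, hsrc, if_false] at hcov
          simp only [if_true, hsrc.symm, if_false] at hb
          simp only at hsum
          change _ ≤ (env.transferBalance src a x).chain.accountBalance a
          simp only [outgoing_append, outgoing_map, if_true]
          linarith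
      · have hst : cfState ((env.transferBalance src dst x).setContractState dst st') a
            = cfState env a := by
          simp [cfState, Environment.setContractState, Environment.transferBalance, h]
        refine ⟨fun act hact hfrom => ?_, fun l hl => hs.consistent l (hst ▸ hl),
          fun l hl => ?_⟩
        · rcases List.mem_append.1 hact with hact | hact
          · obtain ⟨body, -, rfl⟩ := List.mem_map.1 hact
            exact absurd hfrom.symm h
          · exact htr a ha act hact hfrom
        -- Another contract is called: its emitted actions do not count for `a`, and if `a` is the
        -- caller, account and queue total both drop by `x`.
        · have hcov := hs.covered l (hst ▸ hl)
          simp only [outgoing_cons, callBody_amount] at hcov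
          simp only [h, if_false, @eq_comm _ a src] at hb
          change _ ≤ (env.transferBalance src dst x).chain.accountBalance a
          simp only [outgoing_append, outgoing_map, if_neg (Ne.symm h)]
          linarith

theorem Invariant.of_reachable {s : ChainState} (h : Reachable isContract s) :
    Invariant isContract s := by
  induction h with
  | refl => exact .empty
  | tail _ step inv =>
    cases step with
    | block env header acts valid from_users => exact inv.block valid from_users
    | action env env' act acts newActs eval => exact inv.action eval
    | permute env acts acts' perm => exact inv.permute perm

/-- Once all actions are executed, the account of the contract covers its recorded balance. -/
theorem balance_le_accountBalance {env : Environment} {a : Blockchain.Address} {l : State}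
    (h : Reachable isContract ⟨env, []⟩) (ha : env.contracts a = some cfContract.toWeak)
    (hl : cfState env a = some l) : l.balance ≤ env.chain.accountBalance a := by
  simpa [outgoing] using ((Invariant.of_reachable h).sound a ha).covered l hl

end Crowdfunding


theorem mainTheorem4 (isContract : Blockchain.Address → Bool) :
    (∀ (bstate : Blockchain.ChainState) (cfAddr : Blockchain.Address)
        (lstate : Crowdfunding.State),
      Blockchain.Reachable isContract bstate →
      bstate.env.contracts cfAddr = some Crowdfunding.cfContract.toWeak →
      Crowdfunding.cfState bstate.env cfAddr = some lstate →
      Crowdfunding.ConsistentBalance lstate) ∧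
    (∀ (cb : Blockchain.ChainBuilderType isContract) (prev new : cb.Builder)
        (hd : Blockchain.BlockHeader) (acts : List Blockchain.Action)
        (cfAddr : Blockchain.Address) (lstate : Crowdfunding.State),
      cb.addBlock prev hd acts = some new →
      (cb.env new).contracts cfAddr = some Crowdfunding.cfContract.toWeak →
      Crowdfunding.cfState (cb.env new) cfAddr = some lstate →
      (cb.env new).chain.accountBalance cfAddr ≥ lstate.balance) ∧
    (∀ (env : Blockchain.Environment) (cfAddr : Blockchain.Address)
        (lstate : Crowdfunding.State),
      Blockchain.Reachable isContract ⟨env, []⟩ →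
      env.contracts cfAddr = some Crowdfunding.cfContract.toWeak →
      Crowdfunding.cfState env cfAddr = some lstate →
      env.chain.accountBalance cfAddr ≥ lstate.balance) :=
  ⟨fun _ a l h ha hl => ((Crowdfunding.Invariant.of_reachable h).sound a ha).consistent l hl,
    fun cb _ new _ _ _ _ _ ha hl =>
      Crowdfunding.balance_le_accountBalance (cb.trace new) ha hl,
    fun _ _ _ h ha hl => Crowdfunding.balance_le_accountBalance h ha hl⟩
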